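/- Let $X$ be a measurable space, $K\ge 1$, let $\mathcal F_1,\dots,\mathcal F_K$ be nonempty classes of measurable functions $X\to[-1,1]$ (the heterogeneous expert classes), and let $\mathcal G$ be a nonempty class of measurable gating functions $g=(g_1,\dots,g_K)$ on $X$ with $g_k(x)\ge 0$ and $\sum_k g_k(x)=1$. The naive mixture of experts has the function space $$\mathcal F_{\text{Naive-hetero}}=\Big\{x\mapsto \sum_{k=1}^K g_k(x)E_k(x)\ :\ g\in\mathcal G,\ E_k\in\mathcal F_k\Big\}.$$ For a probability measure $\mu$ on $X$ and $n\ge1$, let $$\mathcal R_n(\mathcal F)=\mathbb E_{x_1,\dots,x_n\sim\mu}\,\mathbb E_\sigma \sup_{f\in\mathcal F}\frac1n\sum_{i=1}^n\sigma_i f(x_i)$$ be the Rademacher complexity, where $\sigma$ is uniform on $\{-1,1\}^n$ (the outer expectation over the sample is meant if the supremum is not measurable). For a class $\mathcal F$ and $\epsilon,\delta>0$, let $N_{\mathcal F}(\epsilon,\delta)\in\{1,2,\dots\}\cup\{\infty\}$ be the agnostic sample complexity for the absolute loss: the least $N\ge1$ for which there is a learner, mapping $N$ labelled points to a measurable function $\hat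 h:X\to\mathbb R$, such that for every distribution $D$ on $X\times[-1,1]$, with probability at least $1-\delta$ over $N$ i.i.d. samples from $D$, $\mathbb E_D|\hat h(x)-y|\le\inf_{f\in\mathcal F}\mathbb E_D|f(x)-y|+\epsilon$. Put $N_{\text{Naive}}=N_{\mathcal F_{\text{Naive-hetero}}}$. Then for all $X,\mu,n,K,\mathcal F_1,\dots,\mathcal F_K,\mathcal G$ as above: 1. $\displaystyle \mathcal R_n\Big(\bigcup_{k=1}^K\mathcal F_k\Big)\le\sqrt{\frac{2\log K}{n}}+\sum_{k=1}^K\mathcal R_n(\mathcal F_k)$. 2. If $\mathcal G$ contains the $K$ constant gates that route every input to a single expert, then $\mathcal R_n\big(\bigcup_{k}\mathcal F_k\big)\le\mathcal R_n(\mathcal F_{\text{Naive-hetero}})$. 3. $\displaystyle N_{\text{Naive}}(\epsilon,\delta)\ge c\,\frac{\mathcal R_n(\mathcal F_{\text{Naive-hetero}})^2}{\epsilon^2}$ for all $\epsilon>0$ and $0<\delta\le\delta_0$, where $\delta_0<1/2$ is arbitrary and $c>0$ depends only on $\delta_0$ (not on $X,\mu,n,K$, the classes, $\epsilon$ or $\delta$).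 -/

import Mathlib

open MeasureTheory
open scoped ENNReal

universe u

/-- The outer expectation of a real function `φ` (the infimum of the expectations of the integrable
majorants of `φ`). It is the expectation when `φ` is integrable, and it is the usual meaning of the
expectation of a supremum over an uncountable class, which need not be measurable. -/
noncomputable def outerExpectation {Ω : Type*} [MeasurableSpace Ω] (P : Measure Ω) (φ : Ω → ℝ) : ℝ :=
  sInf {r : ℝ | ∃ h : Ω → ℝ, Integrable h P ∧ (∀ ω, φ ω ≤ h ω) ∧ r = ∫ ω, h ω ∂P}

theorem outerExpectation_eq_integral {Ω : Type*} [MeasurableSpace Ω] (P : Measure Ω) (φ : Ω → ℝ)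
    (hφ : Integrable φ P) : outerExpectation P φ = ∫ ω, φ ω ∂P := by
  refine IsLeast.csInf_eq ⟨⟨φ, hφ, fun _ => le_rfl, rfl⟩, ?_⟩
  rintro r ⟨h, hh, hle, rfl⟩
  exact integral_mono hφ hh hle

/-- The empirical Rademacher complexity of the class `F` on the sample `S`: the average over all
sign vectors `σ ∈ {-1, 1}ⁿ` of `sup_{f ∈ F} (1/n) ∑ i, σ i * f (S i)`. -/
noncomputable def empiricalRademacher {X : Type*} {n : ℕ} (F : Set (X → ℝ)) (S : Fin n → X) : ℝ :=
  (Fintype.card (Fin n → ℤˣ) : ℝ)⁻¹ *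
    ∑ σ : Fin n → ℤˣ, ⨆ f : F, (n : ℝ)⁻¹ * ∑ i, ((σ i : ℤ) : ℝ) * (f : X → ℝ) (S i)

/-- The Rademacher complexity `R_n(F)` with respect to the data distribution `μ`: the expectation of
the empirical Rademacher complexity over an i.i.d. sample of size `n`. -/
noncomputable def rademacher {X : Type*} [MeasurableSpace X] (μ : Measure X) (n : ℕ)
    (F : Set (X → ℝ)) : ℝ :=
  outerExpectation (Measure.pi fun _ : Fin n => μ) (fun S => empiricalRademacher F S)

/-- A naive mixture of `K` heterogeneous experts on `X`: expert classes `F_1, …, F_K` of measurable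
functions with values in `[-1, 1]`, and a class of measurable gating networks, which assign to each
input a vector of `K` nonnegative mixing weights with sum `1`. -/
structure NaiveMoE (X : Type*) [MeasurableSpace X] (K : ℕ) where
  expert : Fin K → Set (X → ℝ)
  gates : Set (X → Fin K → ℝ)
  expert_nonempty : ∀ k, (expert k).Nonempty
  expert_measurable : ∀ k, ∀ f ∈ expert k, Measurable f
  expert_bounded : ∀ k, ∀ f ∈ expert k, ∀ x, |f x| ≤ 1
  gates_nonempty : gates.Nonempty
  gates_measurable : ∀ g ∈ gates, Measurable g
  gates_simplex : ∀ g ∈ gates, ∀ x, g x ∈ stdSimplex ℝ (Fin K)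

namespace NaiveMoE

variable {X : Type*} [MeasurableSpace X] {K : ℕ}

/-- The union of the expert classes. -/
def union (M : NaiveMoE X K) : Set (X → ℝ) := ⋃ k, M.expert k

/-- The function space of the mixture: all functions `x ↦ ∑ k, g_k(x) E_k(x)` with a gating network
`g` and experts `E_k ∈ F_k`. -/
def functionSpace (M : NaiveMoE X K) : Set (X → ℝ) :=
  {h | ∃ g ∈ M.gates, ∃ E : Fin K → X → ℝ, (∀ k, E k ∈ M.expert k) ∧
    h = fun x => ∑ k, g x k * E k x}

end NaiveMoE

/-- The risk of the predictor `h` under the distribution `D` of labelled points, for the absolute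
loss. -/
noncomputable def risk {X : Type*} [MeasurableSpace X] (D : Measure (X × ℝ)) (h : X → ℝ) : ℝ≥0∞ :=
  ∫⁻ p, ENNReal.ofReal |h p.1 - p.2| ∂D

/-- The learner `A` agnostically learns `F` from `N` samples with accuracy `ε` and confidence `δ`:
for every distribution `D` of labelled points with labels in `[-1, 1]`, except with probability at
most `δ` over `N` i.i.d. samples, the risk of the output is at most `ε` above the best risk in `F`.
The output may be any measurable function, in `F` or not. -/
def AgnosticallyLearns {X : Type*} [MeasurableSpace X] (F : Set (X → ℝ)) (ε δ : ℝ) (N : ℕ)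
    (A : (Fin N → X × ℝ) → X → ℝ) : Prop :=
  (∀ S, Measurable (A S)) ∧
  ∀ D : Measure (X × ℝ), IsProbabilityMeasure D → (∀ᵐ p ∂D, p.2 ∈ Set.Icc (-1 : ℝ) 1) →
    (Measure.pi fun _ : Fin N => D)
        {S | (⨅ f ∈ F, risk D f) + ENNReal.ofReal ε < risk D (A S)} ≤ ENNReal.ofReal δ

/-- The (distribution-free, agnostic) sample complexity `N(ε, δ)` of the class `F`: the least
positive sample size from which some learner learns `F` with accuracy `ε` and confidence `δ`
(infinite if there is none). -/
noncomputable def sampleComplexity {X : Type*} [MeasurableSpace X] (F : Set (X → ℝ)) (ε δ : ℝ) :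
    ℕ∞ :=
  ⨅ (N : ℕ) (_ : 1 ≤ N ∧ ∃ A : (Fin N → X × ℝ) → X → ℝ, AgnosticallyLearns F ε δ N A), (N : ℕ∞)

/-! Claim 1: for a fixed sample, the supremum of the signed averages over each class changes by at
most `2 / n` when one sign is flipped, so it is sub-Gaussian around its mean with variance proxy `1
/ n`. The maximum of `K` such variables has mean at most the largest of their means plus `√(2 log K
/ n)`, and the largest mean is at most the sum because all are nonnegative (`signMean_max_le`).
Outer expectation is monotone and finitely subadditive, which carries the bound to `rademacher`.

Claim 2: one-hot gates place every expert in the mixture, and the complexity is monotone in the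
class.

Claim 3: a single point suffices. The complexity `R` is at most the largest gap `f x - g x`, so some
`f`, `g`, `x` have a gap above `R / 2`. Put all the mass at `x`, with a `±1` label of mean `2γ` or
`-2γ`, where `γ = 2ε/R`. An output within `ε` of optimal for both laws cannot exist, so the learner
tests the sign of the bias, and Le Cam's method forces `N ≥ (1 - 2δ)² / (4γ²)` (`sq_le_of_test`,
`AgnosticallyLearns.sq_le`). When `ε > R / 4` the claimed bound is at most `1`. -/

/-- The average of a function over the cube of sign vectors. -/
noncomputable def signMean {n : ℕ} (f : (Fin n → ℤˣ) → ℝ) : ℝ :=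
  (Fintype.card (Fin n → ℤˣ) : ℝ)⁻¹ * ∑ σ, f σ

/-! ### Concentration on the cube of sign vectors. -/

section SignMean

variable {n : ℕ}

theorem signMean_mono {f g : (Fin n → ℤˣ) → ℝ} (h : ∀ σ, f σ ≤ g σ) : signMean f ≤ signMean g :=
  mul_le_mul_of_nonneg_left (Finset.sum_le_sum fun σ _ => h σ) (by positivity)

theorem signMean_const (a : ℝ) : signMean (fun _ : Fin n → ℤˣ => a) = a := by
  unfold signMean
  rw [Finset.sum_const, Finset.card_univ, nsmul_eq_mul, inv_mul_cancel_left₀]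
  positivity

theorem signMean_add (f g : (Fin n → ℤˣ) → ℝ) :
    signMean (fun σ => f σ + g σ) = signMean f + signMean g := by
  simp only [signMean, Finset.sum_add_distrib, mul_add]

theorem signMean_const_mul (a : ℝ) (f : (Fin n → ℤˣ) → ℝ) :
    signMean (fun σ => a * f σ) = a * signMean f := by
  simp only [signMean, ← Finset.mul_sum]; ring

theorem signMean_sub (f g : (Fin n → ℤˣ) → ℝ) :
    signMean (fun σ => f σ - g σ) = signMean f - signMean g := by
  simp only [signMean, Finset.sum_sub_distrib, mul_sub]

theorem signMean_sum {ι : Type*} (s : Finset ι) (f : ι → (Fin n → ℤˣ) → ℝ) :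
    signMean (fun σ => ∑ k ∈ s, f k σ) = ∑ k ∈ s, signMean (f k) := by
  simp only [signMean, ← Finset.mul_sum]
  rw [Finset.sum_comm]

theorem signMean_succ (f : (Fin (n + 1) → ℤˣ) → ℝ) :
    signMean f = (signMean (fun σ => f (Fin.cons 1 σ)) +
      signMean (fun σ => f (Fin.cons (-1) σ))) / 2 := by
  have h : ∑ σ, f σ = ∑ σ : Fin n → ℤˣ, f (Fin.cons 1 σ) + ∑ σ : Fin n → ℤˣ, f (Fin.cons (-1) σ) := by
    rw [← (Fin.consEquiv fun _ => ℤˣ).sum_comp, Fintype.sum_prod_type]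
    simp [UnitsInt.univ, Fin.consEquiv]
  simp only [signMean, h, Fintype.card_pi, Finset.prod_const, Finset.card_univ, Fintype.card_fin,
    Fintype.card_units_int]
  push_cast
  rw [pow_succ]
  field_simp

theorem signMean_sign (i : Fin n) : signMean (fun σ => ((σ i : ℤ) : ℝ)) = 0 := by
  have h : ∑ σ : Fin n → ℤˣ, ((σ i : ℤ) : ℝ) = ∑ σ : Fin n → ℤˣ, -((σ i : ℤ) : ℝ) := by
    rw [← Equiv.sum_comp (Equiv.neg (Fin n → ℤˣ)) fun σ => ((σ i : ℤ) : ℝ)]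
    simp
  rw [Finset.sum_neg_distrib] at h
  simp [signMean, show ∑ σ : Fin n → ℤˣ, ((σ i : ℤ) : ℝ) = 0 by linarith]

theorem exp_signMean_le (f : (Fin n → ℤˣ) → ℝ) :
    Real.exp (signMean f) ≤ signMean fun σ => Real.exp (f σ) := by
  -- Jensen's inequality, from the tangent line of `exp` at the mean.
  have h : ∀ σ, Real.exp (signMean f) * ((f σ - signMean f) + 1) ≤ Real.exp (f σ) := fun σ => by
    calc _ ≤ Real.exp (signMean f) * Real.exp (f σ - signMean f) :=
          mul_le_mul_of_nonneg_left (Real.add_one_le_exp _) (Real.exp_pos _).le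
      _ = _ := by rw [← Real.exp_add]; ring_nf
  have := signMean_mono h
  rw [signMean_const_mul, signMean_add, signMean_sub, signMean_const, signMean_const] at this
  simpa using this

/-- A function on the cube of sign vectors that changes by at most `2 * c` when one sign is flipped
is sub-Gaussian with variance proxy `n * c ^ 2`. -/
theorem signMean_exp_sub_le {c : ℝ} (t : ℝ) : ∀ {n : ℕ} (f : (Fin n → ℤˣ) → ℝ),
    (∀ i σ τ, (∀ j, j ≠ i → σ j = τ j) → f σ - f τ ≤ 2 * c) →
    signMean (fun σ => Real.exp (t * (f σ - signMean f))) ≤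
      Real.exp (n * (t ^ 2 * c ^ 2 / 2)) := by
  intro n
  induction n with
  | zero =>
    intro f _
    have h : ∀ σ, f σ = signMean f := fun σ => by
      rw [← signMean_const (n := 0) (f σ)]
      congr 1; ext τ; congr 1; exact Subsingleton.elim _ _
    simp [h, signMean_const]
  | succ n ih =>
    intro f hf
    have hc : ∀ s : ℤˣ, ∀ i (σ τ : Fin n → ℤˣ), (∀ j, j ≠ i → σ j = τ j) →
        f (Fin.cons s σ) - f (Fin.cons s τ) ≤ 2 * c := fun s i σ τ h => by
      refine hf i.succ _ _ fun j hj => ?_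
      cases j using Fin.cases with
      | zero => rfl
      | succ j => simpa using h j fun e => hj (e ▸ rfl)
    have hd : ∀ s s' : ℤˣ, signMean (fun σ : Fin n → ℤˣ => f (Fin.cons s σ)) -
        signMean (fun σ : Fin n → ℤˣ => f (Fin.cons s' σ)) ≤ 2 * c := fun s s' => by
      rw [← signMean_sub, ← signMean_const (n := n) (2 * c)]
      refine signMean_mono fun σ => hf 0 _ _ fun j hj => ?_
      cases j using Fin.cases with
      | zero => exact absurd rfl hj
      | succ j => rfl
    have h1 := ih _ (hc 1)
    have h2 := ih _ (hc (-1))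
    have d1 := hd 1 (-1)
    have d2 := hd (-1) 1
    -- Split on the first sign. The two half-cube means `a`, `b` lie at `±(a - b) / 2` from the
    -- overall mean, with `|(a - b) / 2| ≤ c`, so this sign contributes a factor of at most `cosh (t
    -- * ((a - b) / 2)) ≤ exp (t² c² / 2)`.
    rw [signMean_succ fun σ => Real.exp (t * (f σ - signMean f)), signMean_succ f]
    set a := signMean fun σ : Fin n → ℤˣ => f (Fin.cons 1 σ)
    set b := signMean fun σ : Fin n → ℤˣ => f (Fin.cons (-1) σ)
    have e1 : (fun σ : Fin n → ℤˣ => Real.exp (t * (f (Fin.cons 1 σ) - (a + b) / 2))) = fun σ =>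
        Real.exp (t * ((a - b) / 2)) * Real.exp (t * (f (Fin.cons 1 σ) - a)) := by
      ext σ; rw [← Real.exp_add]; ring_nf
    have e2 : (fun σ : Fin n → ℤˣ => Real.exp (t * (f (Fin.cons (-1) σ) - (a + b) / 2))) = fun σ =>
        Real.exp (-(t * ((a - b) / 2))) * Real.exp (t * (f (Fin.cons (-1) σ) - b)) := by
      ext σ; rw [← Real.exp_add]; ring_nf
    rw [e1, e2, signMean_const_mul, signMean_const_mul]
    have hab : (t * ((a - b) / 2)) ^ 2 ≤ t ^ 2 * c ^ 2 := by
      rw [mul_pow]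
      exact mul_le_mul_of_nonneg_left (sq_le_sq' (by linarith) (by linarith)) (sq_nonneg t)
    calc _ ≤ (Real.exp (t * ((a - b) / 2)) * Real.exp (n * (t ^ 2 * c ^ 2 / 2)) +
          Real.exp (-(t * ((a - b) / 2))) * Real.exp (n * (t ^ 2 * c ^ 2 / 2))) / 2 := by
          gcongr
      _ = Real.cosh (t * ((a - b) / 2)) * Real.exp (n * (t ^ 2 * c ^ 2 / 2)) := by
          rw [Real.cosh_eq]; ring
      _ ≤ Real.exp ((t * ((a - b) / 2)) ^ 2 / 2) * Real.exp (n * (t ^ 2 * c ^ 2 / 2)) := by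
          gcongr; exact Real.cosh_le_exp_half_sq _
      _ ≤ Real.exp (t ^ 2 * c ^ 2 / 2) * Real.exp (n * (t ^ 2 * c ^ 2 / 2)) := by
          gcongr
      _ = _ := by rw [← Real.exp_add]; push_cast; ring_nf

/-- The maximal inequality for finitely many functions with bounded differences on the cube. -/
theorem signMean_max_le {K : ℕ} (hn : 1 ≤ n) (hK : 1 ≤ K) (Z : Fin K → (Fin n → ℤˣ) → ℝ)
    (hZ : ∀ k i σ τ, (∀ j, j ≠ i → σ j = τ j) → Z k σ - Z k τ ≤ 2 * (n : ℝ)⁻¹)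
    (W : (Fin n → ℤˣ) → ℝ) (hW : ∀ σ, ∃ k, W σ ≤ Z k σ) (a : ℝ) (ha : ∀ k, signMean (Z k) ≤ a) :
    signMean W ≤ Real.sqrt (2 * Real.log (K : ℝ) / (n : ℝ)) + a := by
  have hn' : (0 : ℝ) < n := by exact_mod_cast hn
  have hK' : (0 : ℝ) < K := by exact_mod_cast hK
  rw [← sub_le_iff_le_add]
  by_cases ht : signMean W - a ≤ 0
  · exact ht.trans (Real.sqrt_nonneg _)
  push Not at ht
  set t := signMean W - a with ht_def
  apply Real.le_sqrt_of_sq_le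
  -- Chernoff's method at the optimal exponent `n * t`, with `t` the excess to be bounded: taking
  -- logarithms gives `n t² ≤ log K + n t² / 2`.
  have key : Real.exp (t * n * t) ≤ K * Real.exp (n * ((t * n) ^ 2 * (n : ℝ)⁻¹ ^ 2 / 2)) := by
    calc Real.exp (t * n * t) = Real.exp (signMean fun σ => t * n * (W σ - a)) := by
          rw [signMean_const_mul, signMean_sub, signMean_const]
      _ ≤ _ := exp_signMean_le _
      _ ≤ signMean fun σ => ∑ k, Real.exp (t * n * (Z k σ - signMean (Z k))) := by
          refine signMean_mono fun σ => ?_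
          obtain ⟨k, hk⟩ := hW σ
          refine le_trans ?_ (Finset.single_le_sum
            (f := fun k => Real.exp (t * n * (Z k σ - signMean (Z k))))
            (fun _ _ => (Real.exp_pos _).le) (Finset.mem_univ k))
          have := ha k
          exact Real.exp_le_exp.2 (mul_le_mul_of_nonneg_left (by linarith) (by positivity))
      _ = ∑ k, signMean fun σ => Real.exp (t * n * (Z k σ - signMean (Z k))) := signMean_sum _ _
      _ ≤ ∑ _k : Fin K, Real.exp (n * ((t * n) ^ 2 * (n : ℝ)⁻¹ ^ 2 / 2)) :=
          Finset.sum_le_sum fun k _ => signMean_exp_sub_le _ _ (hZ k)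
      _ = _ := by simp
  rw [← Real.exp_log hK', ← Real.exp_add, Real.exp_le_exp] at key
  rw [le_div_iff₀ hn']
  have e : (n : ℝ) * ((t * n) ^ 2 * (n : ℝ)⁻¹ ^ 2 / 2) = n * t ^ 2 / 2 := by field_simp
  rw [e] at key
  linarith

end SignMean

/-! ### Empirical Rademacher complexity on a fixed sample. -/

section Rademacher

variable {X : Type*} {n : ℕ}

theorem abs_sign (s : ℤˣ) : |((s : ℤ) : ℝ)| = 1 := by
  rcases Int.units_eq_one_or s with rfl | rfl <;> simp

theorem inv_mul_sum_le_of_forall_le (hn : 1 ≤ n) {v : Fin n → ℝ} {b : ℝ} (h : ∀ i, v i ≤ b) :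
    (n : ℝ)⁻¹ * ∑ i, v i ≤ b := by
  have hn' : (0 : ℝ) < n := by exact_mod_cast hn
  rw [inv_mul_le_iff₀ hn']
  simpa using Finset.sum_le_sum fun i (_ : i ∈ Finset.univ) => h i

theorem sign_mul_le (s : ℤˣ) {a b : ℝ} (h : |a| ≤ b) : ((s : ℤ) : ℝ) * a ≤ b :=
  (le_abs_self _).trans (by rwa [abs_mul, abs_sign, one_mul])

/-- The supremum in the empirical Rademacher complexity. -/
noncomputable def signedSup (F : Set (X → ℝ)) (S : Fin n → X) (σ : Fin n → ℤˣ) : ℝ :=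
  ⨆ f : F, (n : ℝ)⁻¹ * ∑ i, ((σ i : ℤ) : ℝ) * (f : X → ℝ) (S i)

theorem empiricalRademacher_eq (F : Set (X → ℝ)) (S : Fin n → X) :
    empiricalRademacher F S = signMean (signedSup F S) := rfl

variable {F G : Set (X → ℝ)} (S : Fin n → X) (σ : Fin n → ℤˣ)

theorem bddAbove_signed (hn : 1 ≤ n) (hF : ∀ f ∈ F, ∀ x, |f x| ≤ 1) :
    BddAbove (Set.range fun f : F => (n : ℝ)⁻¹ * ∑ i, ((σ i : ℤ) : ℝ) * (f : X → ℝ) (S i)) :=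
  ⟨1, by
    rintro _ ⟨f, rfl⟩
    exact inv_mul_sum_le_of_forall_le hn fun i => sign_mul_le _ (hF f f.2 _)⟩

theorem le_signedSup (hn : 1 ≤ n) (hF : ∀ f ∈ F, ∀ x, |f x| ≤ 1) {f : X → ℝ} (hf : f ∈ F) :
    (n : ℝ)⁻¹ * ∑ i, ((σ i : ℤ) : ℝ) * f (S i) ≤ signedSup F S σ :=
  le_ciSup (bddAbove_signed S σ hn hF) ⟨f, hf⟩

theorem signedSup_le (hF : F.Nonempty) {b : ℝ}
    (h : ∀ f ∈ F, (n : ℝ)⁻¹ * ∑ i, ((σ i : ℤ) : ℝ) * f (S i) ≤ b) : signedSup F S σ ≤ b :=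
  have := hF.to_subtype
  ciSup_le fun f => h f f.2

theorem signMean_signed (f : X → ℝ) :
    signMean (fun σ : Fin n → ℤˣ => (n : ℝ)⁻¹ * ∑ i, ((σ i : ℤ) : ℝ) * f (S i)) = 0 := by
  rw [signMean_const_mul, signMean_sum]
  simp only [mul_comm _ (f _), signMean_const_mul, signMean_sign, mul_zero, Finset.sum_const_zero]

theorem empiricalRademacher_nonneg (hn : 1 ≤ n) (hF0 : F.Nonempty)
    (hF : ∀ f ∈ F, ∀ x, |f x| ≤ 1) : 0 ≤ empiricalRademacher F S := by
  obtain ⟨f, hf⟩ := hF0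
  rw [empiricalRademacher_eq, ← signMean_signed S f]
  exact signMean_mono fun σ => le_signedSup S σ hn hF hf

/-- The empirical Rademacher complexity is at most the diameter of the class. -/
theorem empiricalRademacher_le_of_sub_le (hn : 1 ≤ n) (hF0 : F.Nonempty) {d : ℝ}
    (hd : ∀ f ∈ F, ∀ g ∈ F, ∀ x, f x - g x ≤ d) : empiricalRademacher F S ≤ d := by
  obtain ⟨g, hg⟩ := hF0
  -- Recentring at a fixed `g` costs nothing on average, since the signed sum of one function has
  -- mean zero.
  have h : ∀ σ, signedSup F S σ ≤ (n : ℝ)⁻¹ * ∑ i, ((σ i : ℤ) : ℝ) * g (S i) + d := fun σ => by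
    refine signedSup_le S σ ⟨g, hg⟩ fun f hf => ?_
    rw [← sub_le_iff_le_add', ← mul_sub, ← Finset.sum_sub_distrib]
    refine inv_mul_sum_le_of_forall_le hn fun i => ?_
    rw [← mul_sub]
    exact sign_mul_le _ (abs_le.2 ⟨by linarith [hd g hg f hf (S i)], hd f hf g hg _⟩)
  have := signMean_mono h
  rwa [signMean_add, signMean_const, signMean_signed, zero_add] at this

theorem empiricalRademacher_le_one (hn : 1 ≤ n) (hF0 : F.Nonempty)
    (hF : ∀ f ∈ F, ∀ x, |f x| ≤ 1) : empiricalRademacher F S ≤ 1 := by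
  rw [empiricalRademacher_eq, ← signMean_const (n := n) 1]
  exact signMean_mono fun σ => signedSup_le S σ hF0 fun f hf =>
    inv_mul_sum_le_of_forall_le hn fun i => sign_mul_le _ (hF f hf _)

theorem empiricalRademacher_mono (hn : 1 ≤ n) (hF0 : F.Nonempty)
    (hG : ∀ f ∈ G, ∀ x, |f x| ≤ 1) (hFG : F ⊆ G) :
    empiricalRademacher F S ≤ empiricalRademacher G S :=
  signMean_mono fun σ => signedSup_le S σ hF0 fun _ hf => le_signedSup S σ hn hG (hFG hf)

theorem signedSup_sub_le (hn : 1 ≤ n) (hF0 : F.Nonempty) (hF : ∀ f ∈ F, ∀ x, |f x| ≤ 1)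
    (i : Fin n) (σ τ : Fin n → ℤˣ) (h : ∀ j, j ≠ i → σ j = τ j) :
    signedSup F S σ - signedSup F S τ ≤ 2 * (n : ℝ)⁻¹ := by
  rw [sub_le_iff_le_add']
  refine signedSup_le S σ hF0 fun f hf => ?_
  have h1 := le_signedSup S τ hn hF hf
  have h2 : ∑ j, ((σ j : ℤ) : ℝ) * f (S j) - ∑ j, ((τ j : ℤ) : ℝ) * f (S j) ≤ 2 := by
    rw [← Finset.sum_sub_distrib, Finset.sum_eq_single i]
    · have a1 := sign_mul_le (σ i) (hF f hf (S i))
      have a2 := sign_mul_le (-τ i) (hF f hf (S i))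
      push_cast at a2
      linarith
    · intro j _ hj
      rw [h j hj, sub_self]
    · simp
  have h3 := mul_le_mul_of_nonneg_left h2 (inv_nonneg.2 (Nat.cast_nonneg (α := ℝ) n))
  rw [mul_sub] at h3
  linarith

theorem empiricalRademacher_iUnion_le {K : ℕ} (hn : 1 ≤ n) (hK : 1 ≤ K)
    (F : Fin K → Set (X → ℝ)) (hF0 : ∀ k, (F k).Nonempty)
    (hF : ∀ k, ∀ f ∈ F k, ∀ x, |f x| ≤ 1) :
    empiricalRademacher (⋃ k, F k) S ≤
      Real.sqrt (2 * Real.log (K : ℝ) / (n : ℝ)) + ∑ k, empiricalRademacher (F k) S := by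
  have : Nonempty (Fin K) := ⟨⟨0, hK⟩⟩
  refine signMean_max_le hn hK (fun k => signedSup (F k) S)
    (fun k i σ τ => signedSup_sub_le S hn (hF0 k) (hF k) i σ τ) _ (fun σ => ?_) _
    fun k => Finset.single_le_sum (f := fun k => empiricalRademacher (F k) S)
      (fun k _ => empiricalRademacher_nonneg S hn (hF0 k) (hF k)) (Finset.mem_univ k)
  obtain ⟨k, hk⟩ := Finite.exists_max fun k => signedSup (F k) S σ
  refine ⟨k, signedSup_le S σ ((hF0 k).mono (Set.subset_iUnion F k)) fun f hf => ?_⟩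
  obtain ⟨j, hj⟩ := Set.mem_iUnion.1 hf
  exact (le_signedSup S σ hn (hF j) hj).trans (hk j)

end Rademacher

/-! ### Monotonicity and subadditivity of the outer expectation. -/

section OuterExpectation

variable {Ω : Type*} [MeasurableSpace Ω] {P : Measure Ω}

theorem bddBelow_integral_majorants {φ : Ω → ℝ} (hφ : ∀ ω, 0 ≤ φ ω) :
    BddBelow {r : ℝ | ∃ h : Ω → ℝ, Integrable h P ∧ (∀ ω, φ ω ≤ h ω) ∧ r = ∫ ω, h ω ∂P} :=
  ⟨0, by
    rintro r ⟨h, -, hle, rfl⟩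
    exact integral_nonneg fun ω => (hφ ω).trans (hle ω)⟩

theorem outerExpectation_nonneg {φ : Ω → ℝ} (hφ : ∀ ω, 0 ≤ φ ω) : 0 ≤ outerExpectation P φ := by
  refine Real.sInf_nonneg ?_
  rintro r ⟨h, -, hle, rfl⟩
  exact integral_nonneg fun ω => (hφ ω).trans (hle ω)

theorem outerExpectation_le_integral {φ h : Ω → ℝ} (hφ : ∀ ω, 0 ≤ φ ω) (hh : Integrable h P)
    (hle : ∀ ω, φ ω ≤ h ω) : outerExpectation P φ ≤ ∫ ω, h ω ∂P :=
  csInf_le (bddBelow_integral_majorants hφ) ⟨h, hh, hle, rfl⟩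

theorem outerExpectation_le_const [IsProbabilityMeasure P] {φ : Ω → ℝ} {b : ℝ}
    (hφ : ∀ ω, 0 ≤ φ ω) (hb : ∀ ω, φ ω ≤ b) : outerExpectation P φ ≤ b := by
  simpa using outerExpectation_le_integral hφ (integrable_const (μ := P) b) hb

/-- The upper bound `b` supplies an integrable majorant; without one the infimum would be `sInf ∅ =
0` and carry no information. -/
theorem exists_integral_lt [IsFiniteMeasure P] {φ : Ω → ℝ} {b e : ℝ}
    (hb : ∀ ω, φ ω ≤ b) (he : outerExpectation P φ < e) :
    ∃ h : Ω → ℝ, Integrable h P ∧ (∀ ω, φ ω ≤ h ω) ∧ ∫ ω, h ω ∂P < e := by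
  obtain ⟨_, ⟨h, h1, h2, rfl⟩, h3⟩ := exists_lt_of_csInf_lt
    (by exact ⟨_, fun _ => b, integrable_const b, hb, rfl⟩) he
  exact ⟨h, h1, h2, h3⟩

theorem outerExpectation_le_add_sum [IsProbabilityMeasure P] {ι : Type*} [Fintype ι] {ψ : Ω → ℝ}
    {φ : ι → Ω → ℝ} {a b : ℝ} (hψ : ∀ ω, 0 ≤ ψ ω) (hb : ∀ k ω, φ k ω ≤ b)
    (h : ∀ ω, ψ ω ≤ a + ∑ k, φ k ω) :
    outerExpectation P ψ ≤ a + ∑ k, outerExpectation P (φ k) := by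
  refine le_of_forall_pos_le_add fun e he => ?_
  set r := e / (Fintype.card ι + 1)
  have hr : 0 < r := by positivity
  choose g g1 g2 g3 using fun k => exists_integral_lt (P := P) (hb k) (lt_add_of_pos_right _ hr)
  have hi : Integrable (fun ω => ∑ k, g k ω) P := integrable_finsetSum _ fun k _ => g1 k
  have h1 := outerExpectation_le_integral (P := P) hψ ((integrable_const a).add hi)
    fun ω => (h ω).trans (add_le_add_right (Finset.sum_le_sum fun k _ => g2 k ω) a)
  have h2 : ∫ ω, ((fun _ : Ω => a) + fun ω => ∑ k, g k ω) ω ∂P = a + ∑ k, ∫ ω, g k ω ∂P := by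
    rw [integral_add' (integrable_const a) hi, integral_finsetSum _ fun k _ => g1 k]
    simp
  have h3 : ∑ k, ∫ ω, g k ω ∂P ≤ ∑ k, (outerExpectation P (φ k) + r) :=
    Finset.sum_le_sum fun k _ => (g3 k).le
  have h4 : Fintype.card ι * r ≤ e := by
    rw [mul_div_assoc', div_le_iff₀ (by positivity)]
    nlinarith
  rw [Finset.sum_add_distrib, Finset.sum_const, Finset.card_univ, nsmul_eq_mul] at h3
  linarith

theorem outerExpectation_mono [IsFiniteMeasure P] {φ ψ : Ω → ℝ} {b : ℝ} (hφ : ∀ ω, 0 ≤ φ ω)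
    (hψ : ∀ ω, ψ ω ≤ b) (h : ∀ ω, φ ω ≤ ψ ω) : outerExpectation P φ ≤ outerExpectation P ψ := by
  refine le_of_forall_pos_le_add fun e he => ?_
  obtain ⟨g, g1, g2, g3⟩ := exists_integral_lt (P := P) hψ (lt_add_of_pos_right _ he)
  exact (outerExpectation_le_integral hφ g1 fun ω => (h ω).trans (g2 ω)).trans g3.le

end OuterExpectation

/-! ### Testing the sign of a coin's bias. -/

section TwoPoint

/-- The law of a label in `{-1, 1}` (`true` stands for `1`) with mean `2 * γ`. -/
noncomputable def biasedCoin (γ : ℝ) : Measure Bool :=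
  ENNReal.ofReal (1 / 2 + γ) • Measure.dirac true + ENNReal.ofReal (1 / 2 - γ) • Measure.dirac false

theorem isProbabilityMeasure_biasedCoin {γ : ℝ} (h : |γ| ≤ 1 / 2) :
    IsProbabilityMeasure (biasedCoin γ) := by
  obtain ⟨h1, h2⟩ := abs_le.1 h
  refine ⟨?_⟩
  simp only [biasedCoin, Measure.add_apply, Measure.smul_apply, measure_univ, smul_eq_mul, mul_one]
  rw [← ENNReal.ofReal_add (by linarith) (by linarith)]
  norm_num

/-- The weight of `s` under `biasedCoin γ`. -/
noncomputable def coinWeight (γ : ℝ) (s : Bool) : ℝ := if s then 1 / 2 + γ else 1 / 2 - γ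

theorem coinWeight_nonneg {γ : ℝ} (h : |γ| ≤ 1 / 2) (s : Bool) : 0 ≤ coinWeight γ s := by
  obtain ⟨h1, h2⟩ := abs_le.1 h
  cases s <;> simp [coinWeight] <;> linarith

theorem biasedCoin_singleton (γ : ℝ) (s : Bool) :
    biasedCoin γ {s} = ENNReal.ofReal (coinWeight γ s) := by
  cases s <;> simp [biasedCoin, coinWeight]

theorem pi_biasedCoin_apply {γ : ℝ} (h : |γ| ≤ 1 / 2) {N : ℕ} (A : Finset (Fin N → Bool)) :
    Measure.pi (fun _ : Fin N => biasedCoin γ) A =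
      ENNReal.ofReal (∑ s ∈ A, ∏ i, coinWeight γ (s i)) := by
  have := isProbabilityMeasure_biasedCoin h
  rw [← sum_measure_singleton, ENNReal.ofReal_sum_of_nonneg
    fun s _ => Finset.prod_nonneg fun i _ => coinWeight_nonneg h _]
  refine Finset.sum_congr rfl fun s _ => ?_
  rw [Measure.pi_singleton, ENNReal.ofReal_prod_of_nonneg fun i _ => coinWeight_nonneg h _]
  simp only [biasedCoin_singleton]

/-- Le Cam's inequality, the total variation distance being bounded by the Hellinger affinity. -/
theorem sq_sum_sub_le {ι : Type*} [Fintype ι] [DecidableEq ι] {p q : ι → ℝ} (hp : ∀ i, 0 ≤ p i)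
    (hq : ∀ i, 0 ≤ q i) (hp1 : ∑ i, p i = 1) (hq1 : ∑ i, q i = 1) :
    (∑ i, |p i - q i|) ^ 2 ≤ 4 * (1 - (∑ i, Real.sqrt (p i * q i)) ^ 2) := by
  -- Cauchy–Schwarz for `|p - q| = |√p - √q| (√p + √q)`; the two sums of squares are `2 ∓ 2a`, with
  -- `a` the affinity, and their product is `4 (1 - a²)`.
  have h := Finset.sum_mul_sq_le_sq_mul_sq Finset.univ
    (fun i => |Real.sqrt (p i) - Real.sqrt (q i)|) (fun i => Real.sqrt (p i) + Real.sqrt (q i))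
  have e0 : ∀ i, |Real.sqrt (p i) - Real.sqrt (q i)| * (Real.sqrt (p i) + Real.sqrt (q i)) =
      |p i - q i| := fun i => by
    rw [← abs_of_nonneg (add_nonneg (Real.sqrt_nonneg (p i)) (Real.sqrt_nonneg (q i))), ← abs_mul]
    congr 1
    linear_combination Real.sq_sqrt (hp i) - Real.sq_sqrt (hq i)
  have e1 : ∀ i, |Real.sqrt (p i) - Real.sqrt (q i)| ^ 2 =
      p i + q i - 2 * Real.sqrt (p i * q i) := fun i => by
    rw [sq_abs, Real.sqrt_mul (hp i)]
    linear_combination Real.sq_sqrt (hp i) + Real.sq_sqrt (hq i)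
  have e2 : ∀ i, (Real.sqrt (p i) + Real.sqrt (q i)) ^ 2 =
      p i + q i + 2 * Real.sqrt (p i * q i) := fun i => by
    rw [Real.sqrt_mul (hp i)]
    linear_combination Real.sq_sqrt (hp i) + Real.sq_sqrt (hq i)
  simp only [e0, e1, e2, Finset.sum_sub_distrib, Finset.sum_add_distrib, hp1, hq1,
    ← Finset.mul_sum] at h
  linarith

theorem sum_prod_coinWeight (γ : ℝ) (N : ℕ) :
    ∑ s : Fin N → Bool, ∏ i, coinWeight γ (s i) = 1 := by
  rw [← Fintype.prod_sum fun (_ : Fin N) s => coinWeight γ s]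
  simp only [coinWeight, Fintype.sum_bool, if_true, Bool.false_eq_true, if_false]
  norm_num

/-- The affinity factors over the tosses, and both outcomes of a toss give the same product of
weights. -/
theorem sum_sqrt_prod_coinWeight {γ : ℝ} (h : |γ| ≤ 1 / 2) (N : ℕ) :
    ∑ s : Fin N → Bool, Real.sqrt ((∏ i, coinWeight γ (s i)) * ∏ i, coinWeight (-γ) (s i)) =
      Real.sqrt (1 - 4 * γ ^ 2) ^ N := by
  have e : ∀ s, coinWeight γ s * coinWeight (-γ) s = (1 - 4 * γ ^ 2) / 2 ^ 2 := fun s => by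
    cases s <;> simp [coinWeight] <;> ring
  simp only [← Finset.prod_mul_distrib, e, Finset.prod_const, Finset.sum_const, Finset.card_univ,
    Fintype.card_pi, Fintype.card_bool, Fintype.card_fin, nsmul_eq_mul]
  have h0 : 0 ≤ (1 - 4 * γ ^ 2) / 2 ^ 2 := by
    rw [← e true]
    exact mul_nonneg (coinWeight_nonneg h _) (coinWeight_nonneg (by rwa [abs_neg]) _)
  rw [show ((1 - 4 * γ ^ 2) / 2 ^ 2) ^ N = (Real.sqrt ((1 - 4 * γ ^ 2) / 2 ^ 2) ^ N) ^ 2 by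
      rw [pow_right_comm, Real.sq_sqrt h0],
    Real.sqrt_sq (by positivity), Real.sqrt_div' _ (by positivity), Real.sqrt_sq (by norm_num),
    div_pow]
  push_cast
  field_simp

/-- A test of `N` tosses that errs with probability at most `δ` under either of the two opposite
biases needs many tosses. -/
theorem sq_le_of_test {γ δ : ℝ} (h : |γ| ≤ 1 / 2) (hδ0 : 0 ≤ δ) (hδ : δ ≤ 1 / 2) {N : ℕ}
    {A B : Set (Fin N → Bool)} (hAB : A ∪ B = Set.univ)
    (hA : Measure.pi (fun _ : Fin N => biasedCoin γ) A ≤ ENNReal.ofReal δ)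
    (hB : Measure.pi (fun _ : Fin N => biasedCoin (-γ)) B ≤ ENNReal.ofReal δ) :
    (1 - 2 * δ) ^ 2 ≤ 4 * γ ^ 2 * N := by
  classical
  have h' : |-γ| ≤ 1 / 2 := by rwa [abs_neg]
  obtain ⟨A, rfl⟩ : ∃ A' : Finset (Fin N → Bool), A = A' := ⟨A.toFinset, by simp⟩
  set p : (Fin N → Bool) → ℝ := fun s => ∏ i, coinWeight γ (s i)
  set q : (Fin N → Bool) → ℝ := fun s => ∏ i, coinWeight (-γ) (s i)
  have hp : ∀ s, 0 ≤ p s := fun s => Finset.prod_nonneg fun i _ => coinWeight_nonneg h _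
  have hq : ∀ s, 0 ≤ q s := fun s => Finset.prod_nonneg fun i _ => coinWeight_nonneg h' _
  have hA' : ∑ s ∈ A, p s ≤ δ := by
    rwa [pi_biasedCoin_apply h, ENNReal.ofReal_le_ofReal_iff hδ0] at hA
  have hB' : ∑ s ∈ Aᶜ, q s ≤ δ := by
    have : ((Aᶜ : Finset _) : Set (Fin N → Bool)) ⊆ B := fun s hs => by
      have : s ∈ (A : Set (Fin N → Bool)) ∪ B := hAB ▸ Set.mem_univ s
      simpa using this.resolve_left (by simpa using hs)
    have := (measure_mono this).trans hB
    rwa [pi_biasedCoin_apply h', ENNReal.ofReal_le_ofReal_iff hδ0] at this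
  have p1 : ∑ s, p s = 1 := sum_prod_coinWeight _ _
  have q1 : ∑ s, q s = 1 := sum_prod_coinWeight _ _
  have hpA := Finset.sum_add_sum_compl A p
  have hqA := Finset.sum_add_sum_compl A q
  -- `A` has `p`-mass at most `δ` and `q`-mass at least `1 - δ`, and the reverse holds for its
  -- complement, so each contributes `1 - 2δ`.
  have hTV : 2 * (1 - 2 * δ) ≤ ∑ s, |p s - q s| := by
    rw [← Finset.sum_add_sum_compl A]
    have i1 : ∑ s ∈ A, (q s - p s) ≤ ∑ s ∈ A, |p s - q s| :=
      Finset.sum_le_sum fun s _ => by rw [abs_sub_comm]; exact le_abs_self _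
    have i2 : ∑ s ∈ Aᶜ, (p s - q s) ≤ ∑ s ∈ Aᶜ, |p s - q s| :=
      Finset.sum_le_sum fun s _ => le_abs_self _
    rw [Finset.sum_sub_distrib] at i1 i2
    linarith
  have hsq := (pow_le_pow_left₀ (by linarith) hTV 2).trans (sq_sum_sub_le hp hq p1 q1)
  have h4 : 4 * γ ^ 2 ≤ 1 := by
    have := sq_le_sq' (abs_le.1 h).1 (abs_le.1 h).2
    linarith
  have hBC : (∑ s, Real.sqrt (p s * q s)) ^ 2 = (1 - 4 * γ ^ 2) ^ N := by
    rw [sum_sqrt_prod_coinWeight h, pow_right_comm, Real.sq_sqrt (by linarith)]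
  -- Bernoulli's inequality turns `1 - (1 - 4γ²)^N` into `4γ²N`.
  have hbern := one_add_mul_le_pow (show -2 ≤ -(4 * γ ^ 2) by linarith) N
  rw [hBC] at hsq
  rw [← sub_eq_add_neg] at hbern
  linarith

end TwoPoint

/-! ### Learning at a single point as a test. -/

section LowerBound

variable {X : Type*} [MeasurableSpace X]

/-- The law of the labelled point `x` whose label is `±1` with mean `2 * γ`. -/
noncomputable def pointLaw (x : X) (γ : ℝ) : Measure (X × ℝ) :=
  (biasedCoin γ).map fun s => (x, if s then 1 else -1)

theorem risk_pointLaw (x : X) {γ : ℝ} (hγ : |γ| ≤ 1 / 2) {h : X → ℝ} (hh : Measurable h) :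
    risk (pointLaw x γ) h =
      ENNReal.ofReal ((1 / 2 + γ) * |h x - 1| + (1 / 2 - γ) * |h x + 1|) := by
  obtain ⟨h1, h2⟩ := abs_le.1 hγ
  have a1 : 0 ≤ 1 / 2 + γ := by linarith
  have a2 : 0 ≤ 1 / 2 - γ := by linarith
  unfold risk pointLaw
  rw [lintegral_map (by fun_prop) (by fun_prop), biasedCoin, lintegral_add_measure,
    lintegral_smul_measure, lintegral_smul_measure, lintegral_dirac, lintegral_dirac,
    ENNReal.ofReal_add (mul_nonneg a1 (abs_nonneg _)) (mul_nonneg a2 (abs_nonneg _)), ENNReal.ofReal_mul a1,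
    ENNReal.ofReal_mul a2]
  simp

/-- At bias `γ` a prediction `v` has risk at least `1 - 2γv`, with equality on `[-1, 1]`. Success
under both biases would give `1 - 2γv ≤ 1 - 2γ f x + ε` and `1 + 2γv ≤ 1 + 2γ g x + ε`, whose sum
contradicts `hfg`. Hence the two failure sets cover all samples. -/
theorem AgnosticallyLearns.sq_le {F : Set (X → ℝ)} {ε δ : ℝ} {N : ℕ}
    {A : (Fin N → X × ℝ) → X → ℝ} (hA : AgnosticallyLearns F ε δ N A)
    (hm : ∀ f ∈ F, Measurable f) (hb : ∀ f ∈ F, ∀ x, |f x| ≤ 1) (hε : 0 ≤ ε) (hδ0 : 0 ≤ δ)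
    (hδ : δ ≤ 1 / 2) {γ : ℝ} (hγ0 : 0 ≤ γ) (hγ : γ ≤ 1 / 2) {f g : X → ℝ} (hf : f ∈ F)
    (hg : g ∈ F) (x : X) (hfg : ε < γ * (f x - g x)) : (1 - 2 * δ) ^ 2 ≤ 4 * γ ^ 2 * N := by
  have hγ' : |γ| ≤ 1 / 2 := by rwa [abs_of_nonneg hγ0]
  have hγn : |-γ| ≤ 1 / 2 := by rwa [abs_neg]
  obtain ⟨hAm, hA⟩ := hA
  set e : Bool → X × ℝ := fun s => (x, if s then 1 else -1)
  have he : Measurable e := by fun_prop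
  have fail : ∀ η : ℝ, |η| ≤ 1 / 2 → Measure.pi (fun _ : Fin N => biasedCoin η)
      ((fun (s : Fin N → Bool) i => e (s i)) ⁻¹' {S | (⨅ f ∈ F, risk (pointLaw x η) f) + ENNReal.ofReal ε <
        risk (pointLaw x η) (A S)}) ≤ ENNReal.ofReal δ := fun η hη => by
    have := isProbabilityMeasure_biasedCoin hη
    have hp : IsProbabilityMeasure (pointLaw x η) := Measure.isProbabilityMeasure_map he.aemeasurable
    have := Measure.isProbabilityMeasure_map (μ := biasedCoin η) he.aemeasurable
    have hm : Measurable fun (s : Fin N → Bool) i => e (s i) := by fun_prop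
    have hpi : (Measure.pi fun _ : Fin N => biasedCoin η).map (fun s i => e (s i)) =
        Measure.pi fun _ : Fin N => pointLaw x η := Measure.pi_map_pi fun _ => he.aemeasurable
    -- The failure set need not be measurable; this inequality for the pushforward holds for every
    -- set.
    refine (Measure.le_map_apply hm.aemeasurable _).trans ?_
    rw [hpi]
    refine hA (pointLaw x η) hp ((ae_map_iff he.aemeasurable (measurableSet_Icc.preimage measurable_snd)).2
      (Filter.Eventually.of_forall fun s => ?_))
    cases s <;> simp [e]
  refine sq_le_of_test hγ' hδ0 hδ (Set.eq_univ_of_forall fun s => ?_) (fail γ hγ') (fail (-γ) hγn)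
  by_contra hs
  simp only [Set.mem_union, Set.mem_preimage, Set.mem_ofPred_eq, not_or, not_lt] at hs
  obtain ⟨h1, h2⟩ := hs
  set h := A fun i => e (s i)
  replace h1 := h1.trans (add_le_add_left (iInf₂_le f hf) _)
  replace h2 := h2.trans (add_le_add_left (iInf₂_le g hg) _)
  have w1 : 0 ≤ 1 / 2 + γ := by linarith
  have w2 : 0 ≤ 1 / 2 - γ := by linarith
  have w3 : 0 ≤ 1 / 2 + -γ := by linarith
  have w4 : 0 ≤ 1 / 2 - -γ := by linarith
  rw [risk_pointLaw x hγ' (hAm _), risk_pointLaw x hγ' (hm f hf),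
    ← ENNReal.ofReal_add (by positivity) hε, ENNReal.ofReal_le_ofReal_iff (by positivity)] at h1
  rw [risk_pointLaw x hγn (hAm _), risk_pointLaw x hγn (hm g hg),
    ← ENNReal.ofReal_add (by positivity) hε, ENNReal.ofReal_le_ofReal_iff (by positivity)] at h2
  have abs1 : ∀ u ∈ F, |u x - 1| = 1 - u x := fun u hu => by
    rw [abs_sub_comm, abs_of_nonneg (by linarith [(abs_le.1 (hb u hu x)).2])]
  have abs2 : ∀ u ∈ F, |u x + 1| = u x + 1 := fun u hu =>
    abs_of_nonneg (by linarith [(abs_le.1 (hb u hu x)).1])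
  rw [abs1 f hf, abs2 f hf] at h1
  rw [abs1 g hg, abs2 g hg] at h2
  -- The output may leave `[-1, 1]`, so its risk is only bounded below.
  have b1 := neg_le_abs (h x - 1)
  have b2 := le_abs_self (h x + 1)
  have c1 := mul_le_mul_of_nonneg_left b1 w1
  have c2 := mul_le_mul_of_nonneg_left b2 w2
  have c3 := mul_le_mul_of_nonneg_left b1 w3
  have c4 := mul_le_mul_of_nonneg_left b2 w4
  linarith

end LowerBound

/-! ### From empirical bounds to `rademacher` and `sampleComplexity`. -/

section Complexity

variable {X : Type*} [MeasurableSpace X] {μ : Measure X} [IsProbabilityMeasure μ] {n : ℕ}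
  {F : Set (X → ℝ)}

omit [IsProbabilityMeasure μ] in
theorem rademacher_nonneg (hn : 1 ≤ n) (hF0 : F.Nonempty) (hF : ∀ f ∈ F, ∀ x, |f x| ≤ 1) :
    0 ≤ rademacher μ n F :=
  outerExpectation_nonneg fun S => empiricalRademacher_nonneg S hn hF0 hF

theorem exists_lt_sub_of_lt_rademacher (hn : 1 ≤ n) (hF0 : F.Nonempty)
    (hF : ∀ f ∈ F, ∀ x, |f x| ≤ 1) {d : ℝ} (hd : d < rademacher μ n F) :
    ∃ f ∈ F, ∃ g ∈ F, ∃ x, d < f x - g x := by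
  by_contra! h
  exact hd.not_ge (outerExpectation_le_const (fun S => empiricalRademacher_nonneg S hn hF0 hF)
    fun S => empiricalRademacher_le_of_sub_le S hn hF0 h)

theorem rademacher_mono {G : Set (X → ℝ)} (hn : 1 ≤ n) (hF0 : F.Nonempty)
    (hG : ∀ f ∈ G, ∀ x, |f x| ≤ 1) (hFG : F ⊆ G) : rademacher μ n F ≤ rademacher μ n G :=
  outerExpectation_mono
    (fun S => empiricalRademacher_nonneg S hn hF0 fun f hf => hG f (hFG hf))
    (fun S => empiricalRademacher_le_one S hn (hF0.mono hFG) hG)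
    fun S => empiricalRademacher_mono S hn hF0 hG hFG

theorem rademacher_iUnion_le {K : ℕ} (hn : 1 ≤ n) (hK : 1 ≤ K) (F : Fin K → Set (X → ℝ))
    (hF0 : ∀ k, (F k).Nonempty) (hF : ∀ k, ∀ f ∈ F k, ∀ x, |f x| ≤ 1) :
    rademacher μ n (⋃ k, F k) ≤
      Real.sqrt (2 * Real.log (K : ℝ) / (n : ℝ)) + ∑ k, rademacher μ n (F k) :=
  outerExpectation_le_add_sum
    (fun S => empiricalRademacher_nonneg S hn
      ((hF0 ⟨0, hK⟩).mono (Set.subset_iUnion F _)) fun f hf =>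
        (Set.mem_iUnion.1 hf).elim fun k hk => hF k f hk)
    (fun k S => empiricalRademacher_le_one S hn (hF0 k) (hF k))
    fun S => empiricalRademacher_iUnion_le S hn hK F hF0 hF

theorem rademacher_sq_le_sampleComplexity (hn : 1 ≤ n) (hF0 : F.Nonempty)
    (hm : ∀ f ∈ F, Measurable f) (hF : ∀ f ∈ F, ∀ x, |f x| ≤ 1) {ε δ δ₀ : ℝ} (hε : 0 < ε)
    (hδ : 0 < δ) (hδδ₀ : δ ≤ δ₀) (hδ₀ : δ₀ ≤ 1 / 2) :
    ENNReal.ofReal ((1 - 2 * δ₀) ^ 2 / 16 * (rademacher μ n F ^ 2 / ε ^ 2)) ≤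
      (sampleComplexity F ε δ : ℝ≥0∞) := by
  set R := rademacher μ n F
  have hR : 0 ≤ R := rademacher_nonneg hn hF0 hF
  have hc : (1 - 2 * δ₀) ^ 2 ≤ 1 := by nlinarith
  suffices h : ((⌈(1 - 2 * δ₀) ^ 2 / 16 * (R ^ 2 / ε ^ 2)⌉₊ : ℕ) : ℕ∞) ≤ sampleComplexity F ε δ by
    refine le_trans (ENNReal.ofReal_le_of_le_toReal (b := ((⌈_⌉₊ : ℕ) : ℝ≥0∞)) ?_)
      (ENat.toENNReal_mono h)
    rw [ENNReal.toReal_natCast]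
    exact Nat.le_ceil _
  refine le_iInf₂ fun N hN => ?_
  obtain ⟨hN, A, hA⟩ := hN
  rw [Nat.cast_le, Nat.ceil_le]
  have hN' : (1 : ℝ) ≤ N := by exact_mod_cast hN
  rw [mul_div_assoc', div_le_iff₀ (by positivity)]
  -- `ε ≤ R / 4` is exactly the condition for `γ = 2ε/R` to be at most `1 / 2`; otherwise `R² / (16
  -- ε²) < 1 ≤ N`.
  rcases le_or_gt ε (R / 4) with h | h
  · have hRpos : 0 < R := by linarith
    obtain ⟨f, hf, g, hg, x, hfg⟩ :=
      exists_lt_sub_of_lt_rademacher hn hF0 hF (show R / 2 < R by linarith)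
    have key := hA.sq_le hm hF hε.le hδ.le (hδδ₀.trans hδ₀) (γ := 2 * ε / R) (by positivity)
      (by rw [div_le_iff₀ hRpos]; linarith) hf hg x (by
        calc ε = 2 * ε / R * (R / 2) := by field_simp
          _ < _ := mul_lt_mul_of_pos_left hfg (by positivity))
    have h1 : (1 - 2 * δ₀) ^ 2 ≤ (1 - 2 * δ) ^ 2 := pow_le_pow_left₀ (by linarith) (by linarith) 2
    have h2 : 4 * (2 * ε / R) ^ 2 * N * R ^ 2 = 16 * (N * ε ^ 2) := by field_simp; ring
    have h3 := mul_le_mul_of_nonneg_right (h1.trans key) (sq_nonneg R)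
    linarith
  · have h1 : R ^ 2 ≤ (4 * ε) ^ 2 := pow_le_pow_left₀ hR (by linarith) 2
    have h2 := mul_le_mul hc h1 (sq_nonneg R) one_pos.le
    have h3 := mul_le_mul_of_nonneg_right hN' (sq_nonneg ε)
    linarith

end Complexity

/-! ### The mixture class and the theorem. -/

namespace NaiveMoE

variable {X : Type*} [MeasurableSpace X] {K : ℕ} (M : NaiveMoE X K)

theorem functionSpace_nonempty : M.functionSpace.Nonempty := by
  obtain ⟨g, hg⟩ := M.gates_nonempty
  exact ⟨_, g, hg, fun k => (M.expert_nonempty k).some, fun k => (M.expert_nonempty k).some_mem, rfl⟩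

theorem measurable_of_mem_functionSpace : ∀ h ∈ M.functionSpace, Measurable h := by
  rintro _ ⟨g, hg, E, hE, rfl⟩
  exact Finset.measurable_sum _ fun k _ =>
    ((measurable_pi_apply k).comp (M.gates_measurable g hg)).mul (M.expert_measurable k _ (hE k))

theorem abs_le_one_of_mem_functionSpace : ∀ h ∈ M.functionSpace, ∀ x, |h x| ≤ 1 := by
  rintro _ ⟨g, hg, E, hE, rfl⟩ x
  obtain ⟨h0, h1⟩ := M.gates_simplex g hg x
  calc |∑ k, g x k * E k x| ≤ ∑ k, |g x k * E k x| := Finset.abs_sum_le_sum_abs _ _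
    _ ≤ ∑ k, g x k := Finset.sum_le_sum fun k _ => by
        rw [abs_mul, abs_of_nonneg (h0 k)]
        exact mul_le_of_le_one_right (h0 k) (M.expert_bounded k _ (hE k) x)
    _ = 1 := h1

theorem union_nonempty (hK : 1 ≤ K) : M.union.Nonempty :=
  (M.expert_nonempty ⟨0, hK⟩).mono (Set.subset_iUnion M.expert _)

theorem union_subset_functionSpace
    (h : ∀ k : Fin K, (fun _ : X => (Pi.single k 1 : Fin K → ℝ)) ∈ M.gates) :
    M.union ⊆ M.functionSpace := by
  intro f hf
  obtain ⟨k, hk⟩ := Set.mem_iUnion.1 hf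
  -- The experts other than `k` are arbitrary, since the gate gives them weight zero.
  refine ⟨_, h k, Function.update (fun j => (M.expert_nonempty j).some) k f, fun j => ?_, ?_⟩
  · rcases eq_or_ne j k with rfl | hj
    · simpa using hk
    · simpa [hj] using (M.expert_nonempty j).some_mem
  · ext x
    simp [Pi.single_apply]

end NaiveMoE

theorem lemma1 (δ₀ : ℝ) (hδ₀ : δ₀ < 1 / 2) :
    ∃ c : ℝ, 0 < c ∧
      ∀ (X : Type u) [MeasurableSpace X] (μ : Measure X) [IsProbabilityMeasure μ]
        (n : ℕ) (_ : 1 ≤ n) (K : ℕ) (_ : 1 ≤ K) (M : NaiveMoE X K),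
        rademacher μ n M.union
            ≤ Real.sqrt (2 * Real.log (K : ℝ) / (n : ℝ)) + ∑ k, rademacher μ n (M.expert k) ∧
        ((∀ k : Fin K, (fun _ : X => (Pi.single k 1 : Fin K → ℝ)) ∈ M.gates) →
          rademacher μ n M.union ≤ rademacher μ n M.functionSpace) ∧
        ∀ ε δ : ℝ, 0 < ε → 0 < δ → δ ≤ δ₀ →
          ENNReal.ofReal (c * (rademacher μ n M.functionSpace ^ 2 / ε ^ 2))
            ≤ (sampleComplexity M.functionSpace ε δ : ℝ≥0∞) := by
  have hpos : 0 < 1 - 2 * δ₀ := by linarith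
  refine ⟨(1 - 2 * δ₀) ^ 2 / 16, by positivity, ?_⟩
  intro X _ μ _ n hn K hK M
  refine ⟨rademacher_iUnion_le hn hK M.expert M.expert_nonempty M.expert_bounded, fun h => ?_,
    fun ε δ hε hδ hle => ?_⟩
  · exact rademacher_mono hn (M.union_nonempty hK) M.abs_le_one_of_mem_functionSpace
      (M.union_subset_functionSpace h)
  · exact rademacher_sq_le_sampleComplexity hn M.functionSpace_nonempty
      M.measurable_of_mem_functionSpace M.abs_le_one_of_mem_functionSpace hε hδ hle hδ₀.le
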